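/- Let $u>0$, $\alpha>1$, and let $\rho$ be a probability distribution on $[1,\infty)$ such that, for some constant $C>0$, $C^{-1}r^{-\alpha}\le \rho[r,\infty)\le C r^{-\alpha}$ for every $r\ge 1$. The $(u,\rho)$-ellipses model is the Poisson point process $\xi$ on $S=\mathbb{R}^2\times[1,\infty)\times(-\pi/2,\pi/2]$ with intensity measure $(u\lambda)\otimes\rho\otimes\nu$, where $\lambda$ is Lebesgue measure on $\mathbb{R}^2$ and $\nu$ is the uniform distribution on $(-\pi/2,\pi/2]$. A point $s=(z,R,V)\in S$ is identified with the closed, filled ellipse $E(s)\subset\mathbb{R}^2$ with center $z$, semi-major axis of length $R$ in the direction $(\cos V,\sin V)$, and semi-minor axis of length $1$. For $l,k>0$ consider the box $B_\infty(l;k)=[-lk/2,lk/2]\times[-l/2,l/2]$, with left and right sides $L^{\mp}(l;k)=\{\mp lk/2\}\times[-l/2,l/2]$, and let $$LR_1(l;k)=\{\text{there is } s\in\operatorname{supp}\xi \text{ with } E(s)\cap L^-(l;k)\ne\varnothing \text{ and } E(s)\cap L^+(l;k)\ne\varnothing\}$$ be the event that a single ellipse crosses the box from left to right. **Proposition.**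 For every $\alpha>1$ and $C>0$ there is a constant $c=c(\alpha,C)>0$ such that, for every $\rho$ as above, every $u>0$ and all $k,l>0$ with $lk>2$, the set $LR_1(l;k)$ is measurable and $$1-\exp\left[-c^{-1}u\,(k\wedge k^{-\alpha})\,l^{2-\alpha}\right]\le P[LR_1(l;k)]\le 1-\exp\left[-c\,u\,(k^{2-\alpha}\vee k^{-\alpha})\,l^{2-\alpha}\right],$$ where $\wedge$ and $\vee$ denote minimum and maximum. -/

import Mathlib

open MeasureTheory ProbabilityTheory
open scoped ENNReal NNReal

noncomputable section

/-- A point measure on `S`: a locally finite sum `∑ i, δ_{x i}` of Dirac masses over a countable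
family of points of `S`. -/
def IsPointMeasure {S : Type*} [TopologicalSpace S] [MeasurableSpace S] (m : Measure S) : Prop :=
  IsLocallyFiniteMeasure m ∧
    ∃ (ι : Type) (_ : Countable ι) (x : ι → S), m = Measure.sum fun i => Measure.dirac (x i)

/-- `ξ` is a Poisson point process on `S` with intensity measure `μ`, defined on the probability
space `(Ω, P)`: a random point measure such that the number of points in a measurable set `A` is
Poisson distributed with mean `μ A` (almost surely infinite when `μ A = ∞`), and such that the
numbers of points in finitely many pairwise disjoint measurable sets are independent. -/
structure IsPoissonPointProcess {Ω S : Type*} [MeasurableSpace Ω] [TopologicalSpace S]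
    [MeasurableSpace S] (P : Measure Ω) (ξ : Ω → Measure S) (μ : Measure S) : Prop where
  isPointMeasure : ∀ ω, IsPointMeasure (ξ ω)
  measurable : Measurable ξ
  map_apply_eq : ∀ A : Set S, MeasurableSet A → μ A ≠ ∞ →
    P.map (fun ω => ξ ω A) =
      (poissonMeasure (μ A).toNNReal).map (fun n : ℕ => (n : ℝ≥0∞))
  ae_apply_eq_top : ∀ A : Set S, MeasurableSet A → μ A = ∞ → ∀ᵐ ω ∂P, ξ ω A = ∞
  iIndepFun_apply : ∀ (n : ℕ) (A : Fin n → Set S), (∀ i, MeasurableSet (A i)) →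
    Pairwise (fun i j => Disjoint (A i) (A j)) → iIndepFun (fun i ω => ξ ω (A i)) P

/-- The parameter space `ℝ² × [1, ∞) × (-π/2, π/2]` of ellipses: centre, size of the major axis,
direction of the major axis. -/
abbrev EllipseParam : Type :=
  (ℝ × ℝ) × Set.Ici (1 : ℝ) × Set.Ioc (-(Real.pi / 2)) (Real.pi / 2)

/-- The (filled, closed) ellipse with centre `z`, semi-major axis of length `R` in the direction
`(cos V, sin V)`, and semi-minor axis of length `1`. -/
def ellipse (s : EllipseParam) : Set (ℝ × ℝ) :=
  let z := s.1
  let R : ℝ := s.2.1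
  let V : ℝ := s.2.2
  {p | (((p.1 - z.1) * Real.cos V + (p.2 - z.2) * Real.sin V) / R) ^ 2
      + (-(p.1 - z.1) * Real.sin V + (p.2 - z.2) * Real.cos V) ^ 2 ≤ 1}

/-- The uniform distribution on the interval `(-π/2, π/2]` of directions. -/
def directionLaw : Measure (Set.Ioc (-(Real.pi / 2)) (Real.pi / 2)) :=
  (ENNReal.ofReal Real.pi)⁻¹ • (volume : Measure ℝ).comap Subtype.val

/-- `ρ` has tail decay `α` with associated constant `C`. -/
def HasTailDecay (ρ : Measure (Set.Ici (1 : ℝ))) (α C : ℝ) : Prop :=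
  ∀ r : ℝ, 1 ≤ r →
    C⁻¹ * r ^ (-α) ≤ ρ.real {R | r ≤ (R : ℝ)} ∧ ρ.real {R | r ≤ (R : ℝ)} ≤ C * r ^ (-α)

/-- `ξ` is a `(u, ρ)`-ellipses model on `(Ω, P)`: a Poisson point process on the space of ellipses
with intensity `(u · Lebesgue) ⊗ ρ ⊗ uniform`. -/
def IsEllipsesModel {Ω : Type*} [MeasurableSpace Ω] (P : Measure Ω) (ξ : Ω → Measure EllipseParam)
    (u : ℝ) (ρ : Measure (Set.Ici (1 : ℝ))) : Prop :=
  IsPoissonPointProcess P ξ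
    ((ENNReal.ofReal u • (volume : Measure (ℝ × ℝ))).prod (ρ.prod directionLaw))

/-- The left side `{-lk/2} × [-l/2, l/2]` of the box `[-lk/2, lk/2] × [-l/2, l/2]`. -/
def leftSide (l k : ℝ) : Set (ℝ × ℝ) := {-(l * k / 2)} ×ˢ Set.Icc (-(l / 2)) (l / 2)

/-- The right side `{lk/2} × [-l/2, l/2]` of the box `[-lk/2, lk/2] × [-l/2, l/2]`. -/
def rightSide (l k : ℝ) : Set (ℝ × ℝ) := {l * k / 2} ×ˢ Set.Icc (-(l / 2)) (l / 2)

/-- The event that a single ellipse of the process intersects both the left and the right side of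
the box `[-lk/2, lk/2] × [-l/2, l/2]`. -/
def singleEllipseCrossing {Ω : Type*} (ξ : Ω → Measure EllipseParam) (l k : ℝ) : Set Ω :=
  {ω | ∃ s ∈ (ξ ω).support,
    (ellipse s ∩ leftSide l k).Nonempty ∧ (ellipse s ∩ rightSide l k).Nonempty}

end

/-! The support of a locally finite point measure is its set of atoms, so the event says that `ξ`
charges the closed set `A = crossingEllipses l k`. Its probability is 1 - exp(-μ(A)) with μ the
intensity, and everything reduces to two-sided bounds on μ(A).

Upper bound: a crossing ellipse has R ≥ lk/2, and for fixed (R, V) its centre lies in a rotated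
rectangle of area (2R + l)(2 + l). Integrating over R leaves a truncated first moment, finite since
α > 1. As lk > 2 gives 2 + l ≤ l(1 + k), the result is of order u (1 + k)² l² (lk)^(-α).

Lower bound: `A` contains a product set of long, nearly horizontal ellipses, of intensity at least
of order u l² (lk)^(-α) k/(1 + k). Comparing k with 1 turns both bounds into the stated form. -/

theorem MeasureTheory.Measure.sum_dirac_ne_zero_iff {S ι : Type*} [MeasurableSpace S] [Countable ι]
    (x : ι → S) {A : Set S} (hA : MeasurableSet A) :
    Measure.sum (fun i => Measure.dirac (x i)) A ≠ 0 ↔ ∃ i, x i ∈ A := by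
  rw [Measure.sum_apply _ hA, ne_eq, ENNReal.tsum_eq_zero]
  simp [Measure.dirac_apply' _ hA]

/-- The support of a locally finite sum of Dirac masses consists of the atoms. -/
theorem IsPointMeasure.exists_mem_support_iff {S : Type*} [TopologicalSpace S] [T1Space S]
    [MeasurableSpace S] [OpensMeasurableSpace S] {m : Measure S} (hm : IsPointMeasure m)
    {A : Set S} (hA : MeasurableSet A) : (∃ s ∈ m.support, s ∈ A) ↔ m A ≠ 0 := by
  obtain ⟨hfin, ι, _, x, rfl⟩ := hm
  rw [Measure.sum_dirac_ne_zero_iff x hA]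
  constructor
  · rintro ⟨s, hs, hsA⟩
    by_contra! h
    obtain ⟨U, hsU, hU, hUfin⟩ :=
      (Measure.sum fun i => Measure.dirac (x i)).exists_isOpen_measure_lt_top s
    have hF : {i | x i ∈ U}.Finite := by
      rw [Measure.sum_apply _ hU.measurableSet] at hUfin
      have := ENNReal.finite_const_le_of_tsum_ne_top hUfin.ne one_ne_zero
      refine this.subset fun i hi => ?_
      have hi : x i ∈ U := hi
      exact (Measure.dirac_apply_of_mem hi).ge
    -- Deleting the finitely many atoms in `U` leaves a neighbourhood of `s` of mass zero,
    -- contradicting `s` in the support.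
    have hV : IsOpen (U \ (x '' {i | x i ∈ U})) := hU.sdiff (hF.image x).isClosed
    have hpos := (Measure.mem_support_iff_forall s).1 hs _ (hV.mem_nhds ⟨hsU, by
      rintro ⟨i, -, rfl⟩
      exact h i hsA⟩)
    obtain ⟨i, hi⟩ := (Measure.sum_dirac_ne_zero_iff x hV.measurableSet).1 hpos.ne'
    exact hi.2 ⟨i, hi.1, rfl⟩
  · rintro ⟨i, hi⟩
    refine ⟨x i, (Measure.mem_support_iff_forall _).2 fun U hU => ?_, hi⟩
    calc (0 : ℝ≥0∞) < Measure.dirac (x i) U := by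
          simp [Measure.dirac_apply_of_mem (mem_of_mem_nhds hU)]
      _ ≤ _ := Measure.le_sum (fun i => Measure.dirac (x i)) i U

/-! ### Void probabilities -/

namespace IsPoissonPointProcess

variable {Ω S : Type*} [MeasurableSpace Ω] [TopologicalSpace S] [MeasurableSpace S]
  {P : Measure Ω} {ξ : Ω → Measure S} {μ : Measure S}

theorem measurableSet_apply_ne_zero (h : IsPoissonPointProcess P ξ μ) {A : Set S}
    (hA : MeasurableSet A) : MeasurableSet {ω | ξ ω A ≠ 0} :=
  ((Measure.measurable_coe hA).comp h.measurable) (measurableSet_singleton 0).compl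

theorem real_apply_ne_zero [IsProbabilityMeasure P] (h : IsPoissonPointProcess P ξ μ) {A : Set S}
    (hA : MeasurableSet A) (hμ : μ A ≠ ∞) :
    P.real {ω | ξ ω A ≠ 0} = 1 - Real.exp (-μ.real A) := by
  have hm : Measurable fun ω => ξ ω A := (Measure.measurable_coe hA).comp h.measurable
  have h0 : P.real {ω | ξ ω A = 0} = Real.exp (-μ.real A) := by
    have := congrArg (fun ν : Measure ℝ≥0∞ => ν.real {0}) (h.map_apply_eq A hA hμ)
    rw [map_measureReal_apply hm (measurableSet_singleton 0),
      map_measureReal_apply .of_discrete (measurableSet_singleton 0)] at this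
    have e : (fun n : ℕ => (n : ℝ≥0∞)) ⁻¹' {0} = {0} := by ext; simp
    rw [e, poissonMeasure_real_singleton] at this
    simp only [pow_zero, mul_one, Nat.factorial_zero, Nat.cast_one, div_one] at this
    exact this
  have hs : MeasurableSet {ω | ξ ω A = 0} := hm (measurableSet_singleton 0)
  rw [← h0, ← probReal_compl_eq_one_sub hs]
  rfl

end IsPoissonPointProcess

/-! ### Geometry and measurability of crossing ellipses -/

/-- The ellipses that intersect both the left and the right side of the box. -/
def crossingEllipses (l k : ℝ) : Set EllipseParam :=
  {s | (ellipse s ∩ leftSide l k).Nonempty ∧ (ellipse s ∩ rightSide l k).Nonempty}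

theorem isClosed_setOf_mem_ellipse : IsClosed {q : EllipseParam × (ℝ × ℝ) | q.2 ∈ ellipse q.1} := by
  have h : ∀ q : EllipseParam × (ℝ × ℝ), ((q.1.2.1 : ℝ)) ≠ 0 := fun q =>
    (zero_lt_one.trans_le q.1.2.1.2).ne'
  unfold ellipse
  refine isClosed_le (α := ℝ) (β := EllipseParam × (ℝ × ℝ)) ?_ continuous_const
  refine Continuous.add (Continuous.pow (Continuous.div ?_ ?_ h) 2) (Continuous.pow ?_ 2) <;>
    fun_prop

/-- This set is the projection of a closed incidence relation along the compact factor `K`. -/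
theorem isClosed_setOf_ellipse_inter_nonempty {K : Set (ℝ × ℝ)} (hK : IsCompact K) :
    IsClosed {s : EllipseParam | (ellipse s ∩ K).Nonempty} := by
  have : CompactSpace K := isCompact_iff_compactSpace.1 hK
  have h : IsClosed {q : EllipseParam × K | (q.2 : ℝ × ℝ) ∈ ellipse q.1} :=
    isClosed_setOf_mem_ellipse.preimage
      (f := fun q : EllipseParam × K => (q.1, (q.2 : ℝ × ℝ))) (by fun_prop)
  convert isClosedMap_fst_of_compactSpace _ h
  ext s
  constructor
  · rintro ⟨p, hp, hpK⟩
    exact ⟨(s, ⟨p, hpK⟩), hp, rfl⟩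
  · rintro ⟨⟨s, p⟩, hp, rfl⟩
    exact ⟨p, hp, p.2⟩

theorem measurableSet_crossingEllipses (l k : ℝ) : MeasurableSet (crossingEllipses l k) :=
  ((isClosed_setOf_ellipse_inter_nonempty (isCompact_singleton.prod isCompact_Icc)).inter
    (isClosed_setOf_ellipse_inter_nonempty
      (isCompact_singleton.prod isCompact_Icc))).measurableSet

theorem abs_le_of_mem_ellipse {s : EllipseParam} {p : ℝ × ℝ} (hp : p ∈ ellipse s) :
    |(p.1 - s.1.1) * Real.cos s.2.2 + (p.2 - s.1.2) * Real.sin s.2.2| ≤ s.2.1 ∧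
      |-(p.1 - s.1.1) * Real.sin s.2.2 + (p.2 - s.1.2) * Real.cos s.2.2| ≤ 1 := by
  have hR : (1 : ℝ) ≤ s.2.1 := s.2.1.2
  have hp : (((p.1 - s.1.1) * Real.cos s.2.2 + (p.2 - s.1.2) * Real.sin s.2.2) / s.2.1) ^ 2
      + (-(p.1 - s.1.1) * Real.sin s.2.2 + (p.2 - s.1.2) * Real.cos s.2.2) ^ 2 ≤ 1 := hp
  constructor
  · have h := (sq_le_one_iff_abs_le_one _).1 ((le_add_of_nonneg_right (sq_nonneg _)).trans hp)
    rwa [abs_div, abs_of_pos (zero_lt_one.trans_le hR), div_le_one (by linarith)] at h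
  · exact (sq_le_one_iff_abs_le_one _).1 ((le_add_of_nonneg_left (sq_nonneg _)).trans hp)

/-- Since R ≥ 1, the ellipse is contained in the disc of radius R about its centre. -/
theorem abs_fst_sub_le_of_mem_ellipse {s : EllipseParam} {p : ℝ × ℝ} (hp : p ∈ ellipse s) :
    |p.1 - s.1.1| ≤ s.2.1 := by
  have hR : (1 : ℝ) ≤ s.2.1 := s.2.1.2
  have hp : (((p.1 - s.1.1) * Real.cos s.2.2 + (p.2 - s.1.2) * Real.sin s.2.2) / s.2.1) ^ 2
      + (-(p.1 - s.1.1) * Real.sin s.2.2 + (p.2 - s.1.2) * Real.cos s.2.2) ^ 2 ≤ 1 := hp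
  set R : ℝ := (s.2.1 : ℝ)
  set a := (p.1 - s.1.1) * Real.cos s.2.2 + (p.2 - s.1.2) * Real.sin s.2.2 with ha
  set b := -(p.1 - s.1.1) * Real.sin s.2.2 + (p.2 - s.1.2) * Real.cos s.2.2 with hb
  have hab : (p.1 - s.1.1) ^ 2 + (p.2 - s.1.2) ^ 2 = a ^ 2 + b ^ 2 := by
    rw [ha, hb]
    linear_combination (-(p.1 - s.1.1) ^ 2 - (p.2 - s.1.2) ^ 2) * Real.sin_sq_add_cos_sq (s.2.2 : ℝ)
  have h2 : a ^ 2 + R ^ 2 * b ^ 2 ≤ R ^ 2 := by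
    rw [div_pow, div_add' _ _ _ (by positivity), div_le_one (by positivity)] at hp
    linarith
  refine abs_le_of_sq_le_sq ?_ (by linarith)
  nlinarith [sq_nonneg (p.2 - s.1.2), mul_nonneg (by nlinarith : 0 ≤ R ^ 2 - 1) (sq_nonneg b)]

theorem half_width_le_of_mem_crossingEllipses {l k : ℝ} {s : EllipseParam}
    (hs : s ∈ crossingEllipses l k) : l * k / 2 ≤ s.2.1 := by
  obtain ⟨⟨p, hp, hpL⟩, q, hq, hqR⟩ := hs
  have h1 := abs_fst_sub_le_of_mem_ellipse hp
  have h2 := abs_fst_sub_le_of_mem_ellipse hq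
  rw [show p.1 = -(l * k / 2) from hpL.1] at h1
  rw [show q.1 = l * k / 2 from hqR.1] at h2
  rw [abs_le] at h1 h2
  linarith

/-! ### Area of the admissible centres -/

/-- The rotation of the plane by the angle `-V`. -/
noncomputable def planeRotation (V : ℝ) : ℝ × ℝ →ₗ[ℝ] ℝ × ℝ :=
  Matrix.toLin (.finTwoProd ℝ) (.finTwoProd ℝ)
    !![Real.cos V, Real.sin V; -Real.sin V, Real.cos V]

theorem planeRotation_apply (V : ℝ) (z : ℝ × ℝ) : planeRotation V z =
    (Real.cos V * z.1 + Real.sin V * z.2, -Real.sin V * z.1 + Real.cos V * z.2) :=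
  Matrix.toLin_finTwoProd_apply _ _ _ _ _

theorem volume_preimage_planeRotation (V : ℝ) (s : Set (ℝ × ℝ)) :
    volume (planeRotation V ⁻¹' s) = volume s := by
  have hdet : LinearMap.det (planeRotation V) = 1 := by
    rw [planeRotation, LinearMap.det_toLin, Matrix.det_fin_two_of]
    linarith [Real.sin_sq_add_cos_sq V]
  rw [Measure.addHaar_preimage_linearMap _ (by simp [hdet]), hdet]
  simp

/-- The centres of the ellipses of given size and direction crossing the box lie in a set of
area at most `(2 R + l) (2 + l)`. -/
theorem volume_centres_crossingEllipses_le {l : ℝ} (hl : 0 < l) (k : ℝ)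
    (y : Set.Ici (1 : ℝ) × Set.Ioc (-(Real.pi / 2)) (Real.pi / 2)) :
    volume {z : ℝ × ℝ | (z, y) ∈ crossingEllipses l k} ≤
      ENNReal.ofReal ((2 * y.1 + l) * (2 + l)) := by
  have hR : (1 : ℝ) ≤ y.1 := y.1.2
  set a : ℝ := -(l * k / 2) * Real.cos y.2 with ha
  set b : ℝ := l * k / 2 * Real.sin y.2 with hb
  -- Touching the left side alone suffices: in rotated coordinates that side is within l/2 of (a, b)
  -- in each coordinate, and the ellipse extends at most R and 1 from its centre.
  have hsub : {z : ℝ × ℝ | (z, y) ∈ crossingEllipses l k} ⊆ planeRotation y.2 ⁻¹'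
      (Set.Icc (a - l / 2 - y.1) (a + l / 2 + y.1) ×ˢ Set.Icc (b - l / 2 - 1) (b + l / 2 + 1)) := by
    rintro z ⟨⟨⟨p, t⟩, hp, hpL⟩, -⟩
    obtain ⟨h1, h2⟩ := abs_le_of_mem_ellipse hp
    have hp1 : p = -(l * k / 2) := hpL.1
    have ht : |t| ≤ l / 2 := abs_le.2 hpL.2
    subst hp1
    have hts : |t * Real.sin y.2| ≤ l / 2 := by
      rw [abs_mul]
      exact (mul_le_of_le_one_right (abs_nonneg _) (Real.abs_sin_le_one _)).trans ht
    have htc : |t * Real.cos y.2| ≤ l / 2 := by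
      rw [abs_mul]
      exact (mul_le_of_le_one_right (abs_nonneg _) (Real.abs_cos_le_one _)).trans ht
    simp only [abs_le] at h1 h2 hts htc
    simp only [Set.mem_preimage, planeRotation_apply, Set.mem_prod, Set.mem_Icc, ha, hb]
    refine ⟨⟨?_, ?_⟩, ?_, ?_⟩ <;> linarith
  refine (measure_mono hsub).trans_eq ?_
  rw [volume_preimage_planeRotation, Measure.volume_eq_prod, Measure.prod_prod, Real.volume_Icc,
    Real.volume_Icc, ← ENNReal.ofReal_mul (by linarith)]
  congr 1
  ring

/-! ### A product set of crossing ellipses -/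

theorem half_le_cos_and_abs_tan_le {V : ℝ} (hV : |V| ≤ 1 / 8) :
    1 / 2 ≤ Real.cos V ∧ |Real.tan V| ≤ 2 * |V| := by
  have hc : 1 / 2 ≤ Real.cos V := by
    have := Real.one_sub_sq_div_two_le_cos (x := V)
    rw [abs_le] at hV
    nlinarith
  refine ⟨hc, ?_⟩
  rw [Real.tan_eq_sin_div_cos, abs_div, abs_of_pos (by linarith : 0 < Real.cos V),
    div_le_iff₀ (by linarith)]
  have := Real.abs_sin_le_abs (x := V)
  nlinarith [abs_nonneg V]

/-- The point lies on the major axis at distance |x| / cos V ≤ 2|x| from the centre. -/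
theorem axis_point_mem_ellipse {s : EllipseParam} (hc : 1 / 2 ≤ Real.cos s.2.2) {x : ℝ}
    (hx : 2 * |x| ≤ s.2.1) : (s.1.1 + x, s.1.2 + x * Real.tan s.2.2) ∈ ellipse s := by
  have hR : (1 : ℝ) ≤ s.2.1 := s.2.1.2
  have hc0 : Real.cos s.2.2 ≠ 0 := by linarith
  change ((((s.1.1 + x) - s.1.1) * Real.cos s.2.2
      + ((s.1.2 + x * Real.tan s.2.2) - s.1.2) * Real.sin s.2.2) / s.2.1) ^ 2
      + (-((s.1.1 + x) - s.1.1) * Real.sin s.2.2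
        + ((s.1.2 + x * Real.tan s.2.2) - s.1.2) * Real.cos s.2.2) ^ 2 ≤ 1
  have h1 : ((s.1.1 + x) - s.1.1) * Real.cos s.2.2
      + ((s.1.2 + x * Real.tan s.2.2) - s.1.2) * Real.sin s.2.2 = x / Real.cos s.2.2 := by
    rw [Real.tan_eq_sin_div_cos]
    field_simp
    linear_combination x * Real.sin_sq_add_cos_sq (s.2.2 : ℝ)
  have h2 : -((s.1.1 + x) - s.1.1) * Real.sin s.2.2
        + ((s.1.2 + x * Real.tan s.2.2) - s.1.2) * Real.cos s.2.2 = 0 := by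
    rw [Real.tan_eq_sin_div_cos]
    field_simp
    ring
  rw [h1, h2, zero_pow two_ne_zero, add_zero, sq_le_one_iff_abs_le_one, abs_div, abs_div,
    abs_of_pos (by linarith : 0 < Real.cos s.2.2), abs_of_pos (by linarith : (0 : ℝ) < s.2.1),
    div_le_one (by linarith), div_le_iff₀ (by linarith)]
  nlinarith

/-- Long, nearly horizontal ellipses centred in the middle of the box cross it. -/
theorem prod_subset_crossingEllipses {l k : ℝ} (hk : 0 < k) (hl : 0 < l) :
    (Set.Icc (-(l * k / 2)) (l * k / 2) ×ˢ Set.Icc (-(l / 4)) (l / 4)) ×ˢ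
      ({R : Set.Ici (1 : ℝ) | 2 * (l * k) ≤ (R : ℝ)} ×ˢ
        {V : Set.Ioc (-(Real.pi / 2)) (Real.pi / 2) | |(V : ℝ)| ≤ 1 / (8 * (1 + k))}) ⊆
      crossingEllipses l k := by
  rintro s ⟨⟨h1, h2⟩, hR, hV⟩
  have hR : 2 * (l * k) ≤ (s.2.1 : ℝ) := hR
  have hV : |(s.2.2 : ℝ)| ≤ 1 / (8 * (1 + k)) := hV
  have hlk : 0 < l * k := mul_pos hl hk
  obtain ⟨hc, ht⟩ := half_le_cos_and_abs_tan_le (V := s.2.2) (hV.trans (by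
    apply one_div_le_one_div_of_le <;> linarith))
  -- The angle bound makes the axis rise at most l/4 over a horizontal distance lk; with the centre
  -- at height at most l/4, it stays within l/2.
  have hslope : l * k * |Real.tan s.2.2| ≤ l / 4 := by
    have h : l * k * (2 * (1 / (8 * (1 + k)))) ≤ l / 4 := by
      rw [show l * k * (2 * (1 / (8 * (1 + k)))) = l / 4 * (k / (1 + k)) by field_simp; ring]
      refine mul_le_of_le_one_right (by linarith) ?_
      rw [div_le_one (by linarith)]
      linarith
    refine le_trans ?_ h
    gcongr
    linarith
  have key : ∀ x : ℝ, |x| ≤ l * k → s.1.2 + x * Real.tan s.2.2 ∈ Set.Icc (-(l / 2)) (l / 2) := by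
    intro x hx
    have h3 : |x * Real.tan s.2.2| ≤ l / 4 := by
      rw [abs_mul]
      exact (mul_le_mul_of_nonneg_right hx (abs_nonneg _)).trans hslope
    rw [abs_le] at h3
    constructor <;> linarith [h2.1, h2.2]
  have hxl : |-(l * k / 2) - s.1.1| ≤ l * k := abs_le.2 ⟨by linarith [h1.2], by linarith [h1.1]⟩
  have hxr : |l * k / 2 - s.1.1| ≤ l * k := abs_le.2 ⟨by linarith [h1.2], by linarith [h1.1]⟩
  exact ⟨⟨_, axis_point_mem_ellipse hc (by linarith), by simp, key _ hxl⟩,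
    ⟨_, axis_point_mem_ellipse hc (by linarith), by simp, key _ hxr⟩⟩

/-! ### Intensity of the crossing ellipses -/

theorem directionLaw_apply {s : Set (Set.Ioc (-(Real.pi / 2)) (Real.pi / 2))} :
    directionLaw s = (ENNReal.ofReal Real.pi)⁻¹ * volume ((↑) '' s : Set ℝ) := by
  rw [directionLaw, Measure.smul_apply, smul_eq_mul,
    (MeasurableEmbedding.subtype_coe measurableSet_Ioc).comap_apply]

instance : IsProbabilityMeasure directionLaw := by
  constructor
  have h : Real.pi / 2 - -(Real.pi / 2) = Real.pi := by ring
  rw [directionLaw_apply, Set.image_univ, Subtype.range_coe_subtype, Set.ofPred_mem_eq,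
    Real.volume_Ioc, h]
  exact ENNReal.inv_mul_cancel (by simp [Real.pi_pos]) ENNReal.ofReal_ne_top

theorem directionLaw_abs_le {δ : ℝ} (hδ : δ < Real.pi / 2) :
    directionLaw {V | |(V : ℝ)| ≤ δ} = ENNReal.ofReal (2 * δ / Real.pi) := by
  have h : ((↑) '' {V : Set.Ioc (-(Real.pi / 2)) (Real.pi / 2) | |(V : ℝ)| ≤ δ} : Set ℝ) =
      Set.Icc (-δ) δ := by
    ext x
    simp only [Set.mem_image, Set.mem_ofPred_eq, Subtype.exists, abs_le]
    constructor
    · rintro ⟨y, -, hy, rfl⟩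
      exact hy
    · exact fun hx => ⟨x, ⟨by linarith [hx.1], by linarith [hx.2]⟩, hx, rfl⟩
  rw [directionLaw_apply, h, Real.volume_Icc, ← ENNReal.ofReal_inv_of_pos Real.pi_pos,
    ← ENNReal.ofReal_mul (inv_nonneg.2 Real.pi_pos.le)]
  congr 1
  ring

/-- The intensity measure of the ellipses model. -/
noncomputable abbrev ellipsesIntensity (u : ℝ) (ρ : Measure (Set.Ici (1 : ℝ))) :
    Measure EllipseParam :=
  (ENNReal.ofReal u • (volume : Measure (ℝ × ℝ))).prod (ρ.prod directionLaw)

section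

variable {ρ : Measure (Set.Ici (1 : ℝ))} [IsProbabilityMeasure ρ] {α C : ℝ}

theorem HasTailDecay.measure_le (h : HasTailDecay ρ α C) {r : ℝ} (hr : 1 ≤ r) :
    ρ {R | r ≤ (R : ℝ)} ≤ ENNReal.ofReal (C * r ^ (-α)) := by
  rw [← ofReal_measureReal]
  exact ENNReal.ofReal_le_ofReal (h r hr).2

theorem HasTailDecay.le_measure (h : HasTailDecay ρ α C) {r : ℝ} (hr : 1 ≤ r) :
    ENNReal.ofReal (C⁻¹ * r ^ (-α)) ≤ ρ {R | r ≤ (R : ℝ)} := by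
  rw [← ofReal_measureReal]
  exact ENNReal.ofReal_le_ofReal (h r hr).1

theorem lintegral_Ioi_rpow {r : ℝ} (hα : 1 < α) (hC : 0 ≤ C) (hr : 0 < r) :
    ∫⁻ t in Set.Ioi r, ENNReal.ofReal (C * t ^ (-α)) =
      ENNReal.ofReal (C * r ^ (1 - α) / (α - 1)) := by
  rw [← ofReal_integral_eq_lintegral_ofReal
    ((integrableOn_Ioi_rpow_of_lt (by linarith) hr).const_mul C)]
  · rw [integral_const_mul, integral_Ioi_rpow_of_lt (by linarith) hr]
    congr 1
    rw [show -α + 1 = -(α - 1) by ring, neg_div_neg_eq, show -(α - 1) = 1 - α by ring,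
      mul_div_assoc]
  · filter_upwards [self_mem_ae_restrict measurableSet_Ioi] with t ht
    exact mul_nonneg hC (Real.rpow_nonneg (hr.trans ht).le _)

/-- The truncated first moment of a law with tail decay `α > 1`. -/
theorem HasTailDecay.setLIntegral_le (h : HasTailDecay ρ α C) (hα : 1 < α) (hC : 0 ≤ C) {r : ℝ}
    (hr : 1 ≤ r) :
    ∫⁻ R in {R | r ≤ (R : ℝ)}, ENNReal.ofReal (R : ℝ) ∂ρ ≤
      ENNReal.ofReal (C * r ^ (1 - α) * (α / (α - 1))) := by
  have hr0 : 0 < r := by linarith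
  have hr1 : r * r ^ (-α) = r ^ (1 - α) := by
    rw [sub_eq_add_neg, Real.rpow_add hr0, Real.rpow_one]
  -- Layer cake, split at r: levels t ≤ r contribute at most C r^(1-α), levels t > r at most C
  -- r^(1-α)/(α-1), and 1 + 1/(α-1) = α/(α-1).
  rw [lintegral_eq_lintegral_meas_le _
    (.of_forall fun R => zero_le_one.trans R.2) (by fun_prop),
    ← Set.Ioc_union_Ioi_eq_Ioi hr0.le]
  calc _ ≤ (∫⁻ t in Set.Ioc 0 r, ENNReal.ofReal (C * r ^ (-α))) +
          ∫⁻ t in Set.Ioi r, ENNReal.ofReal (C * t ^ (-α)) := by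
        refine (lintegral_union_le _ _ _).trans (add_le_add ?_ ?_)
        · refine lintegral_mono fun t => (measure_mono (Set.subset_univ _)).trans ?_
          rw [Measure.restrict_apply_univ]
          exact h.measure_le hr
        · refine setLIntegral_mono' measurableSet_Ioi fun t ht => ?_
          exact (Measure.restrict_apply_le _ _).trans (h.measure_le (hr.trans (le_of_lt ht)))
    _ = _ := by
        have : (α - 1) ≠ 0 := by linarith
        rw [lintegral_Ioi_rpow hα hC hr0, setLIntegral_const, Real.volume_Ioc, sub_zero,
          ← ENNReal.ofReal_mul (by positivity), ← ENNReal.ofReal_add (by positivity)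
            (div_nonneg (by positivity) (by linarith))]
        congr 1
        rw [mul_assoc, mul_comm _ r, hr1]
        field_simp
        ring

theorem HasTailDecay.intensity_crossingEllipses_le (h : HasTailDecay ρ α C) (hα : 1 < α)
    (hC : 0 ≤ C) {u k l : ℝ} (hk : 0 < k) (hl : 0 < l) (hlk : 2 < l * k) :
    ellipsesIntensity u ρ (crossingEllipses l k) ≤
      ENNReal.ofReal u * ENNReal.ofReal ((2 + l) *
        (2 * (C * (l * k / 2) ^ (1 - α) * (α / (α - 1))) + l * (C * (l * k / 2) ^ (-α)))) := by
  set r := l * k / 2 with hrdef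
  have hr : 1 ≤ r := by rw [hrdef]; linarith
  have hr0 : 0 < r := by linarith
  have hα' : 0 < α / (α - 1) := div_pos (by linarith) (by linarith)
  set T : Set (Set.Ici (1 : ℝ)) := {R | r ≤ (R : ℝ)} with hT
  have hTm : MeasurableSet T := measurableSet_le measurable_const measurable_subtype_coe
  rw [Measure.prod_apply_symm (measurableSet_crossingEllipses l k)]
  calc _ ≤ ∫⁻ y : Set.Ici (1 : ℝ) × Set.Ioc (-(Real.pi / 2)) (Real.pi / 2),
        ENNReal.ofReal u * T.indicator (fun R => ENNReal.ofReal (2 + l) *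
          (2 * ENNReal.ofReal R + ENNReal.ofReal l)) y.1 ∂(ρ.prod directionLaw) := by
        refine lintegral_mono fun y => ?_
        rw [Measure.smul_apply, smul_eq_mul]
        refine mul_le_mul_right ?_ _
        by_cases hy : y.1 ∈ T
        · rw [Set.indicator_of_mem hy]
          refine (volume_centres_crossingEllipses_le hl k y).trans_eq ?_
          have : (1 : ℝ) ≤ y.1 := y.1.2
          rw [mul_comm, ENNReal.ofReal_mul (by linarith : 0 ≤ 2 + l),
            ENNReal.ofReal_add (by linarith : 0 ≤ 2 * (y.1 : ℝ)) hl.le,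
            ENNReal.ofReal_mul (two_pos.le : (0 : ℝ) ≤ 2)]
          simp
        · have : (fun z : ℝ × ℝ => (z, y)) ⁻¹' crossingEllipses l k = ∅ := by
            ext z
            simp only [Set.mem_preimage, Set.mem_empty_iff_false, iff_false]
            exact fun hz => hy (half_width_le_of_mem_crossingEllipses hz)
          rw [this, measure_empty]
          exact zero_le
    _ = ENNReal.ofReal u * (ENNReal.ofReal (2 + l) *
          (2 * (∫⁻ R in T, ENNReal.ofReal R ∂ρ) + ENNReal.ofReal l * ρ T)) := by
        have hfm : Measurable (T.indicator fun R : Set.Ici (1 : ℝ) => ENNReal.ofReal (2 + l) *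
            (2 * ENNReal.ofReal R + ENNReal.ofReal l)) := .indicator (by fun_prop) hTm
        rw [lintegral_const_mul' _ _ ENNReal.ofReal_ne_top,
          measurePreserving_fst.lintegral_comp hfm, lintegral_indicator hTm,
          lintegral_const_mul _ (by fun_prop),
          lintegral_add_right _ measurable_const, lintegral_const_mul _ (by fun_prop),
          setLIntegral_const]
    _ ≤ ENNReal.ofReal u * (ENNReal.ofReal (2 + l) *
          (2 * ENNReal.ofReal (C * r ^ (1 - α) * (α / (α - 1))) +
            ENNReal.ofReal l * ENNReal.ofReal (C * r ^ (-α)))) := by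
        gcongr
        · exact h.setLIntegral_le hα hC hr
        · exact h.measure_le hr
    _ = _ := by
        rw [ENNReal.ofReal_mul (by linarith : 0 ≤ 2 + l),
          ENNReal.ofReal_add
            (by positivity : 0 ≤ 2 * (C * r ^ (1 - α) * (α / (α - 1)))) (by positivity),
          ENNReal.ofReal_mul (p := 2) two_pos.le, ENNReal.ofReal_mul (p := l) hl.le]
        simp

theorem HasTailDecay.le_intensity_crossingEllipses (h : HasTailDecay ρ α C)
    (hC : 0 ≤ C) {u k l : ℝ} (hk : 0 < k) (hl : 0 < l) (hlk : 2 < l * k) :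
    ENNReal.ofReal u * ENNReal.ofReal (l ^ 2 * k / 2 * (C⁻¹ * (2 * (l * k)) ^ (-α)) *
        (2 * (1 / (8 * (1 + k))) / Real.pi)) ≤
      ellipsesIntensity u ρ (crossingEllipses l k) := by
  refine le_trans ?_ (measure_mono (prod_subset_crossingEllipses hk hl))
  have hδ : 1 / (8 * (1 + k)) < Real.pi / 2 := by
    have : 1 / (8 * (1 + k)) ≤ 1 / 8 := one_div_le_one_div_of_le (by norm_num) (by linarith)
    linarith [Real.pi_gt_three]
  have hR := h.le_measure (r := 2 * (l * k)) (by linarith)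
  rw [Measure.prod_prod, Measure.prod_prod, Measure.smul_apply, smul_eq_mul,
    Measure.volume_eq_prod, Measure.prod_prod, Real.volume_Icc, Real.volume_Icc,
    directionLaw_abs_le hδ, ENNReal.ofReal_mul (by positivity),
    ENNReal.ofReal_mul (by positivity : 0 ≤ l ^ 2 * k / 2),
    ← ENNReal.ofReal_mul (by linarith : 0 ≤ l * k / 2 - -(l * k / 2)), mul_assoc, mul_assoc,
    show (l * k / 2 - -(l * k / 2)) * (l / 4 - -(l / 4)) = l ^ 2 * k / 2 by ring]
  gcongr

end

/-! ### Scaling in k and l -/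

theorem mul_rpow_neg_scale {k l : ℝ} (hk : 0 < k) (hl : 0 < l) (α : ℝ) :
    l ^ 2 * (l * k) ^ (-α) = k ^ (-α) * l ^ (2 - α) := by
  rw [Real.mul_rpow hl.le hk.le, sub_eq_add_neg, Real.rpow_add hl, Real.rpow_two]
  ring

/-- The upper bound for the intensity of crossing ellipses in scaling form. -/
theorem crossing_upper_scaling {α C k l : ℝ} (hα : 1 < α) (hC : 0 < C) (hk : 0 < k) (hl : 0 < l)
    (hlk : 2 < l * k) :
    (2 + l) * (2 * (C * (l * k / 2) ^ (1 - α) * (α / (α - 1))) + l * (C * (l * k / 2) ^ (-α))) ≤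
      4 * C * 2 ^ α * (α / (α - 1)) * max (k ^ (2 - α)) (k ^ (-α)) * l ^ (2 - α) := by
  have hlk0 : 0 < l * k := mul_pos hl hk
  set β := α / (α - 1) with hβ
  have hβ1 : 1 ≤ β := by
    rw [hβ, le_div_iff₀ (by linarith)]
    linarith
  set D := (l * k) ^ (-α) with hD
  have hD0 : 0 < D := Real.rpow_pos_of_pos hlk0 _
  have h1 : (l * k / 2) ^ (-α) = 2 ^ α * D := by
    rw [Real.div_rpow hlk0.le two_pos.le, Real.rpow_neg two_pos.le, div_inv_eq_mul, mul_comm]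
  have h2 : (l * k / 2) ^ (1 - α) = l * k / 2 * (2 ^ α * D) := by
    rw [sub_eq_add_neg, Real.rpow_add (by linarith), Real.rpow_one, h1]
  have h3 : k ^ (2 - α) = k ^ 2 * k ^ (-α) := by
    rw [sub_eq_add_neg, Real.rpow_add hk, Real.rpow_two]
  have hkα : 0 < k ^ (-α) := Real.rpow_pos_of_pos hk _
  have hmax : (1 + k) ^ 2 * k ^ (-α) ≤ 4 * max (k ^ (2 - α)) (k ^ (-α)) := by
    rcases le_total k 1 with h | h
    · calc (1 + k) ^ 2 * k ^ (-α) ≤ 4 * k ^ (-α) := by gcongr; nlinarith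
        _ ≤ _ := by gcongr; exact le_max_right _ _
    · calc (1 + k) ^ 2 * k ^ (-α) ≤ 4 * k ^ 2 * k ^ (-α) := by gcongr; nlinarith
        _ = 4 * k ^ (2 - α) := by rw [h3]; ring
        _ ≤ _ := by gcongr; exact le_max_left _ _
  have h2α : (0 : ℝ) < 2 ^ α := Real.rpow_pos_of_pos two_pos _
  have hlα : 0 < l ^ (2 - α) := Real.rpow_pos_of_pos hl _
  rw [h1, h2]
  calc _ = C * 2 ^ α * D * ((2 + l) * (l * k * β + l * 1)) := by ring
    -- Here 2 < lk absorbs the additive 2, and β ≥ 1 allows factoring out β.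
    _ ≤ C * 2 ^ α * D * ((l * k + l) * (l * k * β + l * β)) := by gcongr
    _ = C * 2 ^ α * β * ((1 + k) ^ 2 * (l ^ 2 * D)) := by ring
    _ = C * 2 ^ α * β * ((1 + k) ^ 2 * k ^ (-α)) * l ^ (2 - α) := by
        rw [hD, mul_rpow_neg_scale hk hl]
        ring
    _ ≤ C * 2 ^ α * β * (4 * max (k ^ (2 - α)) (k ^ (-α))) * l ^ (2 - α) := by gcongr
    _ = _ := by ring

/-- The lower bound for the intensity of crossing ellipses in scaling form. -/
theorem crossing_lower_scaling {α C k l : ℝ} (hα : 1 < α) (hC : 0 < C) (hk : 0 < k) (hl : 0 < l) :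
    (16 * C * 2 ^ α * Real.pi)⁻¹ * min k (k ^ (-α)) * l ^ (2 - α) ≤
      l ^ 2 * k / 2 * (C⁻¹ * (2 * (l * k)) ^ (-α)) * (2 * (1 / (8 * (1 + k))) / Real.pi) := by
  have hlk0 : 0 < l * k := mul_pos hl hk
  have hkα : 0 < k ^ (-α) := Real.rpow_pos_of_pos hk _
  have h2α : (0 : ℝ) < 2 ^ α := Real.rpow_pos_of_pos two_pos _
  have hlα : 0 < l ^ (2 - α) := Real.rpow_pos_of_pos hl _
  have hpi := Real.pi_pos
  have hmin : min k (k ^ (-α)) ≤ 2 * (k / (1 + k)) * k ^ (-α) := by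
    rcases le_total k 1 with h | h
    · have h1 : 1 ≤ k ^ (-α) := Real.one_le_rpow_of_pos_of_le_one_of_nonpos hk h (by linarith)
      calc min k (k ^ (-α)) ≤ k * 1 := by rw [mul_one]; exact min_le_left _ _
        _ ≤ 2 * (k / (1 + k)) * k ^ (-α) := by
          gcongr
          rw [← mul_div_assoc, le_div_iff₀ (by linarith)]
          nlinarith
    · calc min k (k ^ (-α)) ≤ 1 * k ^ (-α) := by rw [one_mul]; exact min_le_right _ _
        _ ≤ 2 * (k / (1 + k)) * k ^ (-α) := by
          gcongr
          rw [← mul_div_assoc, le_div_iff₀ (by linarith)]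
          linarith
  calc _ ≤ (16 * C * 2 ^ α * Real.pi)⁻¹ * (2 * (k / (1 + k)) * k ^ (-α)) * l ^ (2 - α) := by gcongr
    _ = (16 * C * 2 ^ α * Real.pi)⁻¹ * (2 * (k / (1 + k))) * (l ^ 2 * (l * k) ^ (-α)) := by
        rw [mul_rpow_neg_scale hk hl]
        ring
    _ = _ := by
        rw [Real.mul_rpow two_pos.le hlk0.le, Real.rpow_neg two_pos.le]
        field_simp
        ring

theorem mainTheorem6 (α : ℝ) (hα : 1 < α) (C : ℝ) (hC : 0 < C) :
    ∃ c : ℝ, 0 < c ∧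
      ∀ (ρ : Measure (Set.Ici (1 : ℝ))), IsProbabilityMeasure ρ → HasTailDecay ρ α C →
      ∀ u : ℝ, 0 < u →
      ∀ (Ω : Type*) [MeasurableSpace Ω] (P : Measure Ω) [IsProbabilityMeasure P]
        (ξ : Ω → Measure EllipseParam), IsEllipsesModel P ξ u ρ →
      ∀ k l : ℝ, 0 < k → 0 < l → 2 < l * k →
        MeasurableSet (singleEllipseCrossing ξ l k) ∧
        1 - Real.exp (-(c⁻¹ * u * min k (k ^ (-α)) * l ^ (2 - α)))
            ≤ P.real (singleEllipseCrossing ξ l k) ∧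
        P.real (singleEllipseCrossing ξ l k)
            ≤ 1 - Real.exp (-(c * u * max (k ^ (2 - α)) (k ^ (-α)) * l ^ (2 - α))) := by
  have h2α : (0 : ℝ) < 2 ^ α := Real.rpow_pos_of_pos two_pos _
  have hpi := Real.pi_pos
  have hβ : 0 < α / (α - 1) := div_pos (by linarith) (by linarith)
  set c₁ : ℝ := 4 * C * 2 ^ α * (α / (α - 1)) with hc₁
  set c₂ : ℝ := 16 * C * 2 ^ α * Real.pi with hc₂
  have hc₁0 : 0 < c₁ := by positivity
  have hc₂0 : 0 < c₂ := by positivity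
  -- Enlarging c weakens both inequalities, so the larger of the two constants serves both.
  refine ⟨max c₁ c₂, lt_max_of_lt_left hc₁0, ?_⟩
  intro ρ _ hρ u hu Ω _ P _ ξ hξ k l hk hl hlk
  have hA := measurableSet_crossingEllipses l k
  have hE : singleEllipseCrossing ξ l k = {ω | ξ ω (crossingEllipses l k) ≠ 0} := by
    ext ω
    exact (hξ.isPointMeasure ω).exists_mem_support_iff hA
  have hup := hρ.intensity_crossingEllipses_le (u := u) hα hC.le hk hl hlk
  have hlow := hρ.le_intensity_crossingEllipses (u := u) hC.le hk hl hlk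
  rw [← ENNReal.ofReal_mul hu.le] at hup hlow
  have hfin : ellipsesIntensity u ρ (crossingEllipses l k) ≠ ∞ :=
    (hup.trans_lt ENNReal.ofReal_lt_top).ne
  have hup' := ENNReal.toReal_le_of_le_ofReal (by positivity) hup
  have hlow' := (ENNReal.ofReal_le_iff_le_toReal hfin).1 hlow
  have hm1 : 0 < max (k ^ (2 - α)) (k ^ (-α)) := lt_max_of_lt_right (Real.rpow_pos_of_pos hk _)
  have hm2 : 0 < min k (k ^ (-α)) := lt_min hk (Real.rpow_pos_of_pos hk _)
  have hlα : 0 < l ^ (2 - α) := Real.rpow_pos_of_pos hl _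
  rw [hE, hξ.real_apply_ne_zero hA hfin]
  refine ⟨hξ.measurableSet_apply_ne_zero hA, ?_, ?_⟩
  · gcongr
    calc (max c₁ c₂)⁻¹ * u * min k (k ^ (-α)) * l ^ (2 - α)
        ≤ c₂⁻¹ * u * min k (k ^ (-α)) * l ^ (2 - α) := by
          gcongr
          exact le_max_right _ _
      _ = u * (c₂⁻¹ * min k (k ^ (-α)) * l ^ (2 - α)) := by ring
      _ ≤ _ := mul_le_mul_of_nonneg_left (crossing_lower_scaling hα hC hk hl) hu.le
      _ ≤ _ := hlow'
  · gcongr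
    calc _ ≤ _ := hup'
      _ ≤ _ := mul_le_mul_of_nonneg_left (crossing_upper_scaling hα hC hk hl hlk) hu.le
      _ = c₁ * u * max (k ^ (2 - α)) (k ^ (-α)) * l ^ (2 - α) := by ring
      _ ≤ _ := by
          gcongr
          exact le_max_left _ _
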